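/- For $n=1,2,\dots$ let $\mathcal H_n^A,\mathcal H_n^B$ be arbitrary finite-dimensional complex Hilbert spaces and let $|\psi_n\rangle,|\phi_n\rangle\in\mathcal H_n^A\otimes\mathcal H_n^B$ be arbitrary unit vectors. Write $\psi_n^{AB}=|\psi_n\rangle\langle\psi_n|$, $\phi_n^{AB}=|\phi_n\rangle\langle\phi_n|$, $\psi_n^A=\mathrm{Tr}_B\,\psi_n^{AB}$, $\phi_n^A=\mathrm{Tr}_B\,\phi_n^{AB}$. For a Hermitian operator $X$ let $\{X>0\}$ be the projection onto the span of the eigenvectors of $X$ with positive eigenvalue. For a sequence $\widehat\rho=\{\rho_n\}_{n\ge1}$ of density operators and $\varepsilon\in[0,1]$ define the sup- and inf-spectral entropy rates $$\overline H(\varepsilon|\widehat\rho)=-\sup\Bigl\{a\in\mathbb R\Bigm|\liminf_{n\to\infty}\mathrm{Tr}\,\rho_n\{\rho_n-e^{na}I_n>0\}\ge1-\varepsilon\Bigr\},$$ $$\underline H(\varepsilon|\widehat\rho)=-\inf\Bigl\{a\in\mathbb R\Bigm|\limsup_{n\to\infty}\mathrm{Tr}\,\rho_n\{\rho_n-e^{na}I_n>0\}\le\varepsilon\Bigr\},$$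 with values in $[-\infty,\infty]$ (so $\sup\emptyset=-\infty$ and $\inf\emptyset=+\infty$). Theorem (converse part). Suppose that $\{\psi_n^{AB}\}_{n\ge1}$ can be asymptotically converted into $\{\phi_n^{AB}\}_{n\ge1}$ by LOCC, that is, there are maps $\mathcal L_n$ on the operators on $\mathcal H_n^A\otimes\mathcal H_n^B$, each implemented by a finite-round protocol of local operations and classical communication, such that $\lim_{n\to\infty}\|\mathcal L_n(\psi_n^{AB})-\phi_n^{AB}\|_1=0$, where $\|X\|_1=\mathrm{Tr}|X|$. Then for every $\varepsilon\in[0,1]$ $$\overline H(\varepsilon|\{\psi_n^A\})\ge\overline H(\varepsilon|\{\phi_n^A\})\quad\text{and}\quad\underline H(\varepsilon|\{\psi_n^A\})\ge\underline H(\varepsilon|\{\phi_n^A\}).$$ -/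

import Mathlib

open Filter
open scoped Matrix Kronecker

noncomputable section

/-! ## Operators on bipartite systems

A finite-dimensional Hilbert space is written as `ℂ^d` in an orthonormal basis, so operators on it
are `d × d` complex matrices and operators on `ℂ^a ⊗ ℂ^b` are matrices indexed by
`Fin a × Fin b`. -/

/-- Operators on `ℂ^a ⊗ ℂ^b`. -/
abbrev BiOp (a b : ℕ) : Type := Matrix (Fin a × Fin b) (Fin a × Fin b) ℂ

/-- The operator `|ψ⟩⟨ψ|` of a vector `ψ ∈ ℂ^a ⊗ ℂ^b`. -/
def pureState {a b : ℕ} (ψ : EuclideanSpace ℂ (Fin a × Fin b)) : BiOp a b :=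
  Matrix.of fun i j => ψ i * star (ψ j)

/-- The partial trace `Tr_B`. -/
def partialTraceB {a b : ℕ} (X : BiOp a b) : Matrix (Fin a) (Fin a) ℂ :=
  Matrix.of fun i j => ∑ k, X (i, k) (j, k)

/-- The trace norm `‖X‖₁ = Tr |X|`, where `|X| = √(X† X)`. -/
def traceNorm {ι : Type*} [Fintype ι] [DecidableEq ι] (X : Matrix ι ι ℂ) : ℝ :=
  (Matrix.trace (cfc Real.sqrt (Xᴴ * X))).re

/-- The spectral projection `{X > 0}` of a Hermitian matrix `X`: the sum of the spectral
projections belonging to the positive eigenvalues. (Every function is continuous on the finite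
spectrum of a matrix, so the functional calculus applies to the indicator function.) -/
def posProj {ι : Type*} [Fintype ι] [DecidableEq ι] (X : Matrix ι ι ℂ) : Matrix ι ι ℂ :=
  cfc (fun x : ℝ => if 0 < x then (1 : ℝ) else 0) X

/-! ## LOCC -/

/-- `X ↦ (K ⊗ I) X (K ⊗ I)†`, for an operator `K : ℂ^a → ℂ^c` on the first party. -/
def conjAlice {a c : ℕ} (b : ℕ) (K : Matrix (Fin c) (Fin a) ℂ) : BiOp a b →ₗ[ℂ] BiOp c b where
  toFun X := (K ⊗ₖ (1 : Matrix (Fin b) (Fin b) ℂ)) * X * (K ⊗ₖ (1 : Matrix (Fin b) (Fin b) ℂ))ᴴ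
  map_add' X Y := by rw [Matrix.mul_add, Matrix.add_mul]
  map_smul' t X := by simp

/-- `X ↦ (I ⊗ K) X (I ⊗ K)†`, for an operator `K : ℂ^b → ℂ^c` on the second party. -/
def conjBob {b c : ℕ} (a : ℕ) (K : Matrix (Fin c) (Fin b) ℂ) : BiOp a b →ₗ[ℂ] BiOp a c where
  toFun X := ((1 : Matrix (Fin a) (Fin a) ℂ) ⊗ₖ K) * X * ((1 : Matrix (Fin a) (Fin a) ℂ) ⊗ₖ K)ᴴ
  map_add' X Y := by rw [Matrix.mul_add, Matrix.add_mul]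
  map_smul' t X := by simp

/-- `IsLOCC a' b' a b L`: the map `L` from operators on `ℂ^a ⊗ ℂ^b` to operators on
`ℂ^a' ⊗ ℂ^b'` is implemented by a protocol of local operations and classical communication with
finitely many rounds.

The protocol either stops (`done`), or one party applies a quantum instrument to its system and
tells the outcome `x` to the other party, after which they go on with an LOCC protocol that may
depend on `x`. The instrument has finitely many outcomes; its branch `x` is the completely positive
map `X ↦ ∑ j, K x j X (K x j)†` into a system of arbitrary finite dimension `c x`, and the sum over
all branches is trace preserving. In particular local isometries, measurements, and the addition
and removal of local ancillary systems are allowed at every step. -/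
inductive IsLOCC (a' b' : ℕ) : (a b : ℕ) → (BiOp a b →ₗ[ℂ] BiOp a' b') → Prop
  | done : IsLOCC a' b' a' b' LinearMap.id
  | alice {a b m r : ℕ} (c : Fin m → ℕ)
      (K : (x : Fin m) → Fin r → Matrix (Fin (c x)) (Fin a) ℂ)
      (hK : ∑ x, ∑ j, (K x j)ᴴ * K x j = 1)
      (L : (x : Fin m) → BiOp (c x) b →ₗ[ℂ] BiOp a' b')
      (hL : ∀ x, IsLOCC a' b' (c x) b (L x)) :
      IsLOCC a' b' a b (∑ x, L x ∘ₗ ∑ j, conjAlice b (K x j))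
  | bob {a b m r : ℕ} (c : Fin m → ℕ)
      (K : (x : Fin m) → Fin r → Matrix (Fin (c x)) (Fin b) ℂ)
      (hK : ∑ x, ∑ j, (K x j)ᴴ * K x j = 1)
      (L : (x : Fin m) → BiOp a (c x) →ₗ[ℂ] BiOp a' b')
      (hL : ∀ x, IsLOCC a' b' a (c x) (L x)) :
      IsLOCC a' b' a b (∑ x, L x ∘ₗ ∑ j, conjBob a (K x j))

/-- The sequence of pure states `ψ n` can be asymptotically converted into `φ n` by LOCC
(`n = 1, 2, …`; the index `0` plays no role). -/
def AsympLOCCConvertible {dA dB : ℕ → ℕ}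
    (ψ φ : (n : ℕ) → EuclideanSpace ℂ (Fin (dA n) × Fin (dB n))) : Prop :=
  ∃ L : (n : ℕ) → BiOp (dA n) (dB n) →ₗ[ℂ] BiOp (dA n) (dB n),
    (∀ n, 1 ≤ n → IsLOCC (dA n) (dB n) (dA n) (dB n) (L n)) ∧
    Tendsto (fun n => traceNorm (L n (pureState (ψ n)) - pureState (φ n))) atTop (nhds 0)

/-! ## Spectral divergence and entropy rates

The rates are extended reals: the supremum and infimum below run over real numbers `a` and are
taken in `[-∞, ∞]`. -/

/-- `Tr ρ_n {ρ_n - e^{na} σ_n > 0}`. -/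
def spectralWeight {d : ℕ → ℕ} (ρ σ : (n : ℕ) → Matrix (Fin (d n)) (Fin (d n)) ℂ)
    (a : ℝ) (n : ℕ) : ℝ :=
  (Matrix.trace (ρ n * posProj (ρ n - Real.exp (n * a) • σ n))).re

/-- The inf-spectral divergence rate
`sup {a | liminf Tr ρ_n {ρ_n - e^{na} σ_n > 0} ≥ 1 - ε}`. -/
def infSpectralDivergence {d : ℕ → ℕ} (ε : ℝ)
    (ρ σ : (n : ℕ) → Matrix (Fin (d n)) (Fin (d n)) ℂ) : EReal :=
  ⨆ (a : ℝ) (_ : ((1 - ε : ℝ) : EReal) ≤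
    liminf (fun n => (spectralWeight ρ σ a n : EReal)) atTop), (a : EReal)

/-- The sup-spectral divergence rate
`inf {a | limsup Tr ρ_n {ρ_n - e^{na} σ_n > 0} ≤ ε}`. -/
def supSpectralDivergence {d : ℕ → ℕ} (ε : ℝ)
    (ρ σ : (n : ℕ) → Matrix (Fin (d n)) (Fin (d n)) ℂ) : EReal :=
  ⨅ (a : ℝ) (_ : limsup (fun n => (spectralWeight ρ σ a n : EReal)) atTop ≤ (ε : EReal)),
    (a : EReal)

/-- The inf-spectral entropy rate `H̲(ε|ρ) = -D̅(ε|ρ‖I)`. -/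
def infSpectralEntropy {d : ℕ → ℕ} (ε : ℝ)
    (ρ : (n : ℕ) → Matrix (Fin (d n)) (Fin (d n)) ℂ) : EReal :=
  -supSpectralDivergence ε ρ (fun _ => 1)

/-- The sup-spectral entropy rate `H̅(ε|ρ) = -D̲(ε|ρ‖I)`. -/
def supSpectralEntropy {d : ℕ → ℕ} (ε : ℝ)
    (ρ : (n : ℕ) → Matrix (Fin (d n)) (Fin (d n)) ℂ) : EReal :=
  -infSpectralDivergence ε ρ (fun _ => 1)

end

/-!
The converse reduces to a one-shot inequality for the spectral weight
`W_ρ(t) = Tr ρ {ρ > t}` of the reduced states (`IsLOCC.weight_le`): if an LOCC map `L` takes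
`ψ` to within trace distance `η = ‖L(ψ) - φ‖₁` of `φ`, then for `0 ≤ s` and `0 < t`
`W_{ψ^A}(t) - s / t - 2 √η ≤ W_{φ^A}(s)`.
With `t = e^{na}` and `s = e^{n(a - δ)}` the error is `e^{-nδ} + 2 √η_n → 0`, so the spectral
weights of `φ` at rate `a - δ` asymptotically dominate those of `ψ` at rate `a`, for every
`δ > 0`; this compares both divergence rates.

The one-shot inequality is a Schmidt rank argument. An LOCC map has Kraus operators of product form
`M_i = A_i ⊗ B_i` (`IsLOCC.exists_product_kraus`), and these do not increase the Schmidt rank. Put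
`P = {ψ^A > t}` and `χ = (P ⊗ I) ψ`. Then `‖χ‖² = ⟨ψ, χ⟩ = W_{ψ^A}(t)`, and the Schmidt rank of
`χ` is at most `rank P ≤ 1 / t`. A vector `v` of Schmidt rank at most `k` satisfies
`|⟨φ, v⟩|² ≤ (W_{φ^A}(s) + s k) ‖v‖²` (`norm_inner_sq_le_of_rank`), which applies to every `M_i χ`.
On the other hand `L(ψ) ≈ φ` says that the vectors `M_i ψ` are nearly parallel to `φ`
(`one_sub_traceNorm_le`), and since `∑ i, ⟨M_i ψ, M_i χ⟩ = ⟨ψ, χ⟩`, the vectors `M_i χ` must then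
have a large component along `φ` (`sub_two_mul_sqrt_le_of_overlap`).
-/

/-! ### An overlap inequality in Hilbert space -/

/-- Here `u i` and `v i` are the branches of two vectors under an isometry, the second having
squared norm `W` and inner product `W` with the first. If the `u i` are nearly parallel to `φ`, then
the `v i` have total squared overlap at least `(√W - √η)² W` with `φ` (if `η ≤ W`), so an upper
bound `C` for the relative overlap of each `v i` cannot be much smaller than `W`. -/
theorem sub_two_mul_sqrt_le_of_overlap {F κ : Type*} [NormedAddCommGroup F]
    [InnerProductSpace ℂ F] [Fintype κ] (u v : κ → F) {φ : F} (hφ : ‖φ‖ = 1) {W C η : ℝ}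
    (hW0 : 0 ≤ W) (hW1 : W ≤ 1) (hC : 0 ≤ C) (hu : ∑ i, ‖u i‖ ^ 2 = 1)
    (hv : ∑ i, ‖v i‖ ^ 2 = W) (huv : ∑ i, inner ℂ (u i) (v i) = (W : ℂ))
    (hη : 1 - η ≤ ∑ i, ‖inner ℂ φ (u i)‖ ^ 2)
    (hvC : ∀ i, ‖inner ℂ φ (v i)‖ ^ 2 ≤ C * ‖v i‖ ^ 2) :
    W - 2 * √η ≤ C := by
  -- Split each `u i` into its component along `φ` and the orthogonal remainder.
  have hr (i) : ‖u i - inner ℂ φ (u i) • φ‖ ^ 2 = ‖u i‖ ^ 2 - ‖inner ℂ φ (u i)‖ ^ 2 := by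
    have h : inner ℂ (u i - inner ℂ φ (u i) • φ) (inner ℂ φ (u i) • φ) = 0 := by
      rw [inner_smul_right, inner_sub_left, inner_smul_left, inner_self_eq_norm_sq_to_K, hφ,
        inner_conj_symm]
      simp
    have h2 := norm_add_sq_eq_norm_sq_add_norm_sq_of_inner_eq_zero _ _ h
    rw [sub_add_cancel, norm_smul, hφ] at h2
    nlinarith
  have hc1 : ∑ i, ‖inner ℂ φ (u i)‖ ^ 2 ≤ 1 := by
    rw [← hu]
    refine Finset.sum_le_sum fun i _ => ?_
    have := hr i
    have := sq_nonneg ‖u i - inner ℂ φ (u i) • φ‖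
    linarith
  have hrsum : ∑ i, ‖u i - inner ℂ φ (u i) • φ‖ ^ 2 ≤ η := by
    simp_rw [hr, Finset.sum_sub_distrib, hu]
    linarith
  have hd : ∑ i, ‖inner ℂ φ (v i)‖ ^ 2 ≤ C * W := by
    rw [← hv, Finset.mul_sum]
    exact Finset.sum_le_sum fun i _ => hvC i
  -- Cauchy–Schwarz, applied separately to the two components of `∑ i, ⟨u i, v i⟩ = W`.
  have hkey : W ≤ √C * √W + √η * √W := by
    calc W = ‖∑ i, inner ℂ (u i) (v i)‖ := by
          rw [huv, Complex.norm_real, Real.norm_of_nonneg hW0]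
      _ ≤ ∑ i, ‖inner ℂ (u i) (v i)‖ := norm_sum_le _ _
      _ ≤ ∑ i, (‖inner ℂ φ (u i)‖ * ‖inner ℂ φ (v i)‖
            + ‖u i - inner ℂ φ (u i) • φ‖ * ‖v i‖) := by
          refine Finset.sum_le_sum fun i _ => ?_
          have : inner ℂ (u i) (v i) = starRingEnd ℂ (inner ℂ φ (u i)) * inner ℂ φ (v i)
              + inner ℂ (u i - inner ℂ φ (u i) • φ) (v i) := by
            rw [inner_sub_left, inner_smul_left]; ring
          rw [this]
          refine (norm_add_le _ _).trans (add_le_add ?_ (norm_inner_le_norm _ _))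
          rw [norm_mul, RCLike.norm_conj]
      _ ≤ √(∑ i, ‖inner ℂ φ (u i)‖ ^ 2) * √(∑ i, ‖inner ℂ φ (v i)‖ ^ 2)
            + √(∑ i, ‖u i - inner ℂ φ (u i) • φ‖ ^ 2) * √(∑ i, ‖v i‖ ^ 2) := by
          rw [Finset.sum_add_distrib]
          exact add_le_add (Real.sum_mul_le_sqrt_mul_sqrt _ _ _)
            (Real.sum_mul_le_sqrt_mul_sqrt _ _ _)
      _ ≤ 1 * √(C * W) + √η * √W := by
          rw [hv]
          gcongr
          exact Real.sqrt_le_one.mpr hc1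
      _ = _ := by rw [one_mul, Real.sqrt_mul hC]
  have hη0 := Real.sqrt_nonneg η
  have hs0 := Real.sqrt_nonneg W
  have hC0 := Real.sqrt_nonneg C
  have hs1 : √W ≤ 1 := Real.sqrt_le_one.mpr hW1
  have hWs := Real.sq_sqrt hW0
  have hCs := Real.sq_sqrt hC
  rcases hs0.eq_or_lt with h | h
  · nlinarith
  have h1 : √W ≤ √C + √η := by
    by_contra! hlt
    nlinarith
  rcases le_total (√W) (√η) with h2 | h2
  · nlinarith
  · nlinarith [mul_self_le_mul_self (sub_nonneg.2 h2) (by linarith : √W - √η ≤ √C),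
      mul_nonneg hη0 (sub_nonneg.2 hs1)]

/-! ### Comparison of limits inferior and superior -/

theorem liminf_le_liminf_of_sub_le {u v e : ℕ → ℝ} (he : Tendsto e atTop (nhds 0))
    (h : ∀ᶠ n in atTop, u n - e n ≤ v n) :
    liminf (fun n => (u n : EReal)) atTop ≤ liminf (fun n => (v n : EReal)) atTop := by
  refine le_liminf_iff (by isBoundedDefault) (by isBoundedDefault) |>.2 fun y hy => ?_
  obtain ⟨x, hyx, hx⟩ := EReal.lt_iff_exists_real_btwn.1 hy
  obtain ⟨z, hxz, hz⟩ := EReal.lt_iff_exists_real_btwn.1 hx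
  filter_upwards [h, eventually_lt_of_lt_liminf hz,
    he.eventually_lt_const (sub_pos.2 (EReal.coe_lt_coe_iff.1 hxz))] with n h1 h2 h3
  refine hyx.trans (EReal.coe_lt_coe_iff.2 ?_)
  have := EReal.coe_lt_coe_iff.1 h2
  linarith

theorem limsup_le_limsup_of_sub_le {u v e : ℕ → ℝ} (he : Tendsto e atTop (nhds 0))
    (h : ∀ᶠ n in atTop, u n - e n ≤ v n) :
    limsup (fun n => (u n : EReal)) atTop ≤ limsup (fun n => (v n : EReal)) atTop := by
  refine limsup_le_iff (by isBoundedDefault) (by isBoundedDefault) |>.2 fun y hy => ?_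
  obtain ⟨x, hx, hxy⟩ := EReal.lt_iff_exists_real_btwn.1 hy
  obtain ⟨z, hz, hzx⟩ := EReal.lt_iff_exists_real_btwn.1 hx
  filter_upwards [h, eventually_lt_of_limsup_lt hz,
    he.eventually_lt_const (sub_pos.2 (EReal.coe_lt_coe_iff.1 hzx))] with n h1 h2 h3
  refine lt_trans (EReal.coe_lt_coe_iff.2 ?_) hxy
  have := EReal.coe_lt_coe_iff.1 h2
  linarith

/-! ### Spectral projections and the trace norm -/

section PosProj

open scoped ComplexOrder MatrixOrder

variable {ι : Type*} [Fintype ι] [DecidableEq ι]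

theorem isHermitian_cfc (f : ℝ → ℝ) (X : Matrix ι ι ℂ) :
    (cfc f X).IsHermitian := cfc_predicate f X

theorem posSemidef_cfc {f : ℝ → ℝ} {X : Matrix ι ι ℂ}
    (hf : ∀ x ∈ spectrum ℝ X, 0 ≤ f x) : (cfc f X).PosSemidef :=
  Matrix.nonneg_iff_posSemidef.1 (cfc_nonneg hf)

theorem posProj_mul_self (X : Matrix ι ι ℂ) :
    posProj X * posProj X = posProj X := by
  unfold posProj
  rw [← cfc_mul _ _ X (X.finite_real_spectrum.continuousOn _)
    (X.finite_real_spectrum.continuousOn _)]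
  congr 1; ext x; split_ifs <;> simp

theorem mul_posProj {X : Matrix ι ι ℂ}
    (hX : X.IsHermitian) : X * posProj X = cfc (fun x : ℝ => max x 0) X := by
  unfold posProj
  nth_rw 1 [← cfc_id' ℝ X hX.isSelfAdjoint]
  rw [← cfc_mul _ _ X (X.finite_real_spectrum.continuousOn _)
    (X.finite_real_spectrum.continuousOn _)]
  congr 1; ext x; split_ifs with h
  · simp [h.le]
  · simp [not_lt.1 h]

/-- `X {X > 0}` is the positive part of `X`, so it dominates `X`. -/
theorem posSemidef_mul_posProj_sub_self {X : Matrix ι ι ℂ}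
    (hX : X.IsHermitian) : (X * posProj X - X).PosSemidef := by
  rw [mul_posProj hX]
  nth_rw 2 [← cfc_id' ℝ X hX.isSelfAdjoint]
  rw [← cfc_sub _ _ X (X.finite_real_spectrum.continuousOn _)
    (X.finite_real_spectrum.continuousOn _)]
  exact posSemidef_cfc fun x _ => by simp

theorem posSemidef_mul_posProj {X : Matrix ι ι ℂ} (hX : X.IsHermitian) :
    (X * posProj X).PosSemidef := by
  rw [mul_posProj hX]
  exact posSemidef_cfc fun x _ => le_max_right _ _

theorem isHermitian_posProj (X : Matrix ι ι ℂ) : (posProj X).IsHermitian :=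
  isHermitian_cfc _ X

theorem posSemidef_posProj (X : Matrix ι ι ℂ) : (posProj X).PosSemidef :=
  posSemidef_cfc fun x _ => by split_ifs <;> simp

/-- For positive semidefinite `X`, `{X > 0}` is the projection onto the range of `X`. -/
theorem posProj_mul_of_posSemidef {X : Matrix ι ι ℂ} (hX : X.PosSemidef) :
    posProj X * X = X := by
  have h : X * posProj X = X := by
    rw [mul_posProj hX.isHermitian]
    conv_rhs => rw [← cfc_id' ℝ X hX.isHermitian.isSelfAdjoint]
    refine cfc_congr fun x hx => max_eq_left ?_
    exact spectrum_nonneg_of_nonneg (Matrix.nonneg_iff_posSemidef.2 hX) hx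
  have h2 := congrArg Matrix.conjTranspose h
  rwa [Matrix.conjTranspose_mul, hX.isHermitian, isHermitian_posProj X] at h2

theorem rank_posProj_le {X : Matrix ι ι ℂ} (hX : X.IsHermitian) : (posProj X).rank ≤ X.rank := by
  -- `{X > 0}` is `X` times the inverse of its positive part.
  have h : posProj X = X * cfc (fun x : ℝ => if 0 < x then x⁻¹ else 0) X := by
    conv_rhs => enter [1]; rw [← cfc_id' ℝ X hX.isSelfAdjoint]
    rw [← cfc_mul _ _ X (X.finite_real_spectrum.continuousOn _)
      (X.finite_real_spectrum.continuousOn _)]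
    refine cfc_congr fun x _ => ?_
    split_ifs with hx
    · rw [mul_inv_cancel₀ hx.ne']
    · rw [mul_zero]
  rw [h]
  exact Matrix.rank_mul_le_left _ _

theorem trace_eq_rank_of_isIdempotentElem {P : Matrix ι ι ℂ} (hP : P * P = P) :
    P.trace = P.rank := by
  have h : IsIdempotentElem P.toLin' := by
    rw [IsIdempotentElem, Module.End.mul_eq_comp, ← Matrix.toLin'_mul, hP]
  have := (LinearMap.IsIdempotentElem.isProj_range _ h).trace
  rwa [Matrix.trace_toLin'_eq] at this

omit [DecidableEq ι] in
theorem trace_mul_re_nonneg {A Q : Matrix ι ι ℂ} (hA : A.PosSemidef) (hQ : Q.IsHermitian)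
    (hQQ : Q * Q = Q) : 0 ≤ (A * Q).trace.re := by
  have h := (hA.conjTranspose_mul_mul_same Q).trace_nonneg
  rw [hQ, Matrix.trace_mul_cycle, hQQ, Matrix.trace_mul_comm] at h
  exact (Complex.nonneg_iff.1 h).1

/-- The Neyman–Pearson type bound `Tr ρ Q ≤ Tr ρ {ρ > s} + s rank Q` for a projection `Q`: with
`X = ρ - s`, both `X {X > 0} - X` and `X {X > 0}` are positive semidefinite, whence
`Tr X Q ≤ Tr X {X > 0} Q ≤ Tr X {X > 0}`. -/
theorem trace_mul_projection_re_le {ρ Q : Matrix ι ι ℂ} (hρ : ρ.IsHermitian) (hQ : Q.IsHermitian)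
    (hQQ : Q * Q = Q) {s : ℝ} (hs : 0 ≤ s) :
    (ρ * Q).trace.re ≤ (ρ * posProj (ρ - s • 1)).trace.re + s * Q.rank := by
  set X := ρ - s • (1 : Matrix ι ι ℂ) with hXdef
  have hX : X.IsHermitian := hρ.sub (by simp [Matrix.IsHermitian])
  have hρX : ρ = X + s • 1 := by simp [hXdef]
  have h1 := trace_mul_re_nonneg (posSemidef_mul_posProj_sub_self hX) hQ hQQ
  have h2 := trace_mul_re_nonneg (posSemidef_mul_posProj hX)
    (Matrix.isHermitian_one.sub hQ) (by simp [Matrix.sub_mul, Matrix.mul_sub, hQQ])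
  have h3 := (Complex.nonneg_iff.1 (posSemidef_posProj X).trace_nonneg).1
  have h4 := trace_eq_rank_of_isIdempotentElem hQQ
  rw [hρX, Matrix.add_mul, Matrix.add_mul]
  simp only [Matrix.sub_mul, Matrix.mul_sub, Matrix.trace_sub, Matrix.trace_add, Complex.sub_re,
    Complex.add_re, Matrix.mul_one, Matrix.smul_mul, Matrix.one_mul, Matrix.trace_smul, h4,
    Complex.smul_re, smul_eq_mul, Complex.natCast_re] at h1 h2 h3 ⊢
  nlinarith [mul_nonneg hs h3]

/-- Markov's inequality for the number of eigenvalues of `ρ` above `t`. -/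
theorem mul_rank_posProj_le {ρ : Matrix ι ι ℂ} (hρ : ρ.IsHermitian) (t : ℝ) :
    t * (posProj (ρ - t • 1)).rank ≤ (ρ * posProj (ρ - t • 1)).trace.re := by
  set X := ρ - t • (1 : Matrix ι ι ℂ) with hXdef
  have hX : X.IsHermitian := hρ.sub (by simp [Matrix.IsHermitian])
  have hρX : ρ = X + t • 1 := by simp [hXdef]
  have h2 := (Complex.nonneg_iff.1 (posSemidef_mul_posProj hX).trace_nonneg).1
  have h4 := trace_eq_rank_of_isIdempotentElem (posProj_mul_self X)
  rw [hρX, Matrix.add_mul]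
  simp only [Matrix.trace_add, Complex.add_re, Matrix.smul_mul, Matrix.one_mul, Matrix.trace_smul,
    h4, Complex.smul_re, smul_eq_mul, Complex.natCast_re]
  linarith

theorem trace_mul_posProj_re_le {ρ : Matrix ι ι ℂ} (hρ : ρ.PosSemidef) (X : Matrix ι ι ℂ) :
    (ρ * posProj X).trace.re ≤ ρ.trace.re := by
  have h := trace_mul_re_nonneg hρ (Matrix.isHermitian_one.sub (isHermitian_posProj X))
    (Q := 1 - posProj X) (by simp [Matrix.sub_mul, Matrix.mul_sub, posProj_mul_self])
  simp only [Matrix.mul_sub, Matrix.trace_sub, Complex.sub_re, Matrix.mul_one] at h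
  linarith

theorem sqrt_le_trace_cfc_sqrt {H : Matrix ι ι ℂ} (hH : H.IsHermitian) {x : ℝ}
    (hx : x ∈ spectrum ℝ H) : √x ≤ (cfc Real.sqrt H).trace.re := by
  have h : (cfc Real.sqrt H).trace = ∑ i, ((√(hH.eigenvalues i) : ℝ) : ℂ) := by
    rw [hH.cfc_eq, Matrix.IsHermitian.cfc, Unitary.conjStarAlgAut_apply, Matrix.trace_mul_cycle]
    simp [Matrix.trace_diagonal]
  rw [hH.spectrum_real_eq_range_eigenvalues] at hx
  obtain ⟨i, rfl⟩ := hx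
  rw [h, ← Complex.ofReal_sum, Complex.ofReal_re]
  exact Finset.single_le_sum (f := fun i => √(hH.eigenvalues i))
    (fun i _ => Real.sqrt_nonneg _) (Finset.mem_univ i)

theorem traceNorm_nonneg (X : Matrix ι ι ℂ) : 0 ≤ traceNorm X :=
  (Complex.nonneg_iff.1
    (posSemidef_cfc (f := Real.sqrt) (X := Xᴴ * X) fun x _ => Real.sqrt_nonneg x).trace_nonneg).1

/-- `X† X ≤ ‖X‖₁² I`: every singular value is at most the sum of all of them. -/
theorem posSemidef_sq_traceNorm_sub (X : Matrix ι ι ℂ) :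
    ((traceNorm X ^ 2) • (1 : Matrix ι ι ℂ) - Xᴴ * X).PosSemidef := by
  have hH : (Xᴴ * X).IsHermitian := Matrix.isHermitian_conjTranspose_mul_self X
  have h : cfc (fun x : ℝ => traceNorm X ^ 2 - x) (Xᴴ * X)
      = (traceNorm X ^ 2) • (1 : Matrix ι ι ℂ) - Xᴴ * X := by
    rw [cfc_sub _ _ _ (Matrix.finite_real_spectrum.continuousOn _)
      (Matrix.finite_real_spectrum.continuousOn _), cfc_const _ _ hH.isSelfAdjoint,
      cfc_id' ℝ _ hH.isSelfAdjoint, Algebra.algebraMap_eq_smul_one]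
  rw [← h]
  refine posSemidef_cfc fun x hx => sub_nonneg.2 ?_
  exact (Real.sqrt_le_left (traceNorm_nonneg X)).1 (sqrt_le_trace_cfc_sqrt hH hx)

omit [DecidableEq ι] in
theorem star_dotProduct_self_eq_norm_sq (x : EuclideanSpace ℂ ι) :
    star x.ofLp ⬝ᵥ x.ofLp = ((‖x‖ ^ 2 : ℝ) : ℂ) := by
  rw [dotProduct_comm, ← EuclideanSpace.inner_eq_star_dotProduct]
  simp

/-- The operator norm is at most the trace norm. -/
theorem norm_toLp_mulVec_le (X : Matrix ι ι ℂ) (φ : EuclideanSpace ℂ ι) :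
    ‖WithLp.toLp 2 (X *ᵥ φ.ofLp)‖ ≤ traceNorm X * ‖φ‖ := by
  have h := (posSemidef_sq_traceNorm_sub X).dotProduct_mulVec_nonneg φ.ofLp
  have h1 : star φ.ofLp ⬝ᵥ ((Xᴴ * X) *ᵥ φ.ofLp)
      = ((‖WithLp.toLp 2 (X *ᵥ φ.ofLp)‖ ^ 2 : ℝ) : ℂ) := by
    rw [← star_dotProduct_self_eq_norm_sq, ← Matrix.mulVec_mulVec, Matrix.star_mulVec,
      ← Matrix.dotProduct_mulVec]
  have h2 : star φ.ofLp ⬝ᵥ φ.ofLp = ((‖φ‖ ^ 2 : ℝ) : ℂ) := star_dotProduct_self_eq_norm_sq φ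
  rw [Matrix.sub_mulVec, dotProduct_sub, h1, Matrix.smul_mulVec, Matrix.one_mulVec,
    dotProduct_smul, h2] at h
  have h3 := (Complex.nonneg_iff.1 h).1
  simp only [Complex.sub_re, Complex.smul_re, Complex.ofReal_re, smul_eq_mul] at h3
  refine (sq_le_sq₀ (norm_nonneg _) (mul_nonneg (traceNorm_nonneg X) (norm_nonneg _))).1 ?_
  rw [mul_pow]
  linarith

end PosProj

section Bipartite

open scoped ComplexOrder

/-! ### Coefficient matrices and Schmidt rank -/

/-- The coefficient matrix of a vector of `ℂ^a ⊗ ℂ^b`; its rank is the Schmidt rank of the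
vector. -/
def coeffMatrix {a b : ℕ} (v : EuclideanSpace ℂ (Fin a × Fin b)) : Matrix (Fin a) (Fin b) ℂ :=
  Matrix.of fun i j => v (i, j)

theorem inner_eq_trace {a b : ℕ} (x y : EuclideanSpace ℂ (Fin a × Fin b)) :
    inner ℂ x y = ((coeffMatrix x)ᴴ * coeffMatrix y).trace := by
  simp only [EuclideanSpace.inner_eq_star_dotProduct, dotProduct, Matrix.trace, Matrix.diag,
    Matrix.mul_apply, coeffMatrix, Matrix.conjTranspose_apply, Matrix.of_apply, Pi.star_apply,
    Fintype.sum_prod_type]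
  rw [Finset.sum_comm]
  simp_rw [mul_comm]

theorem partialTraceB_pureState {a b : ℕ} (x : EuclideanSpace ℂ (Fin a × Fin b)) :
    partialTraceB (pureState x) = coeffMatrix x * (coeffMatrix x)ᴴ := by
  ext i j
  simp [partialTraceB, pureState, coeffMatrix, Matrix.mul_apply]

theorem trace_partialTraceB_pureState {a b : ℕ} (x : EuclideanSpace ℂ (Fin a × Fin b)) :
    (partialTraceB (pureState x)).trace = ((‖x‖ ^ 2 : ℝ) : ℂ) := by
  rw [partialTraceB_pureState, Matrix.trace_mul_comm, ← inner_eq_trace,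
    inner_self_eq_norm_sq_to_K]
  simp

theorem coeffMatrix_kronecker_mulVec {a b c d : ℕ} (A : Matrix (Fin c) (Fin a) ℂ)
    (B : Matrix (Fin d) (Fin b) ℂ) (x : EuclideanSpace ℂ (Fin a × Fin b)) :
    coeffMatrix (WithLp.toLp 2 ((A ⊗ₖ B) *ᵥ x.ofLp)) = A * coeffMatrix x * Bᵀ := by
  ext i j
  simp only [coeffMatrix, Matrix.of_apply, Matrix.mulVec, dotProduct, Matrix.kroneckerMap_apply,
    Fintype.sum_prod_type, Matrix.mul_apply, Matrix.transpose_apply, Finset.sum_mul]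
  rw [Finset.sum_comm]
  refine Finset.sum_congr rfl fun k _ => Finset.sum_congr rfl fun l _ => by ring

theorem posSemidef_partialTraceB_pureState {a b : ℕ} (x : EuclideanSpace ℂ (Fin a × Fin b)) :
    (partialTraceB (pureState x)).PosSemidef := by
  rw [partialTraceB_pureState]; exact Matrix.posSemidef_self_mul_conjTranspose _

/-- A vector of Schmidt rank at most `k` overlaps with `φ` by at most the sum of the `k` largest
eigenvalues of `φ^A`, which in turn is at most `Tr φ^A {φ^A > s} + s k`. -/
theorem norm_inner_sq_le_of_rank {a b : ℕ} (φ v : EuclideanSpace ℂ (Fin a × Fin b)) {s : ℝ}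
    (hs : 0 ≤ s) :
    ‖inner ℂ φ v‖ ^ 2 ≤ ((partialTraceB (pureState φ) *
        posProj (partialTraceB (pureState φ) - s • 1)).trace.re
        + s * (coeffMatrix v).rank) * ‖v‖ ^ 2 := by
  set V := coeffMatrix v with hV
  set Q := posProj (V * Vᴴ) with hQ
  -- `Q` is the projection onto the range of `V`, so `v = (Q ⊗ I) v` and `φ` may be replaced by
  -- `w = (Q ⊗ I) φ` in the inner product.
  have hQh : Q.IsHermitian := isHermitian_posProj _
  have hQQ : Q * Q = Q := posProj_mul_self _
  have hQV : Q * V = V := by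
    have h1 : Q * (V * Vᴴ) = V * Vᴴ :=
      posProj_mul_of_posSemidef (Matrix.posSemidef_self_mul_conjTranspose V)
    have h2 : (1 - Q) * (V * Vᴴ) = 0 := by
      rw [Matrix.sub_mul, h1, Matrix.one_mul, sub_self]
    rw [Matrix.mul_self_mul_conjTranspose_eq_zero, Matrix.sub_mul, Matrix.one_mul,
      sub_eq_zero] at h2
    exact h2.symm
  have hrank : Q.rank ≤ V.rank :=
    (rank_posProj_le (Matrix.isHermitian_mul_conjTranspose_self V)).trans
      (Matrix.rank_self_mul_conjTranspose V).le
  let w : EuclideanSpace ℂ (Fin a × Fin b) :=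
    WithLp.toLp 2 ((Q ⊗ₖ (1 : Matrix (Fin b) (Fin b) ℂ)) *ᵥ φ.ofLp)
  have hw : coeffMatrix w = Q * coeffMatrix φ := by
    rw [coeffMatrix_kronecker_mulVec, Matrix.transpose_one, Matrix.mul_one]
  have hin : inner ℂ φ v = inner ℂ w v := by
    rw [inner_eq_trace, inner_eq_trace, hw, Matrix.conjTranspose_mul, hQh, Matrix.mul_assoc, ← hV,
      hQV]
  have hwn : ‖w‖ ^ 2 = (partialTraceB (pureState φ) * Q).trace.re := by
    have h := trace_partialTraceB_pureState w
    rw [partialTraceB_pureState, hw, Matrix.conjTranspose_mul, hQh, ← Matrix.mul_assoc,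
      Matrix.trace_mul_comm, ← Matrix.mul_assoc, ← Matrix.mul_assoc, hQQ, Matrix.mul_assoc,
      Matrix.trace_mul_comm, ← partialTraceB_pureState] at h
    rw [h, Complex.ofReal_re]
  have hb := trace_mul_projection_re_le (posSemidef_partialTraceB_pureState φ).isHermitian
    hQh hQQ hs
  calc ‖inner ℂ φ v‖ ^ 2 ≤ (‖w‖ * ‖v‖) ^ 2 := by
        rw [hin]; gcongr; exact norm_inner_le_norm _ _
    _ = ‖w‖ ^ 2 * ‖v‖ ^ 2 := mul_pow _ _ _
    _ ≤ _ := by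
        gcongr
        rw [hwn]
        refine hb.trans (add_le_add le_rfl ?_)
        gcongr

/-! ### Product Kraus operators of LOCC maps -/

theorem sum_conjTranspose_mul_self_comp {ι ι' ι'' κ : Type*} [Fintype ι'] [Fintype ι'']
    [Fintype κ] [DecidableEq ι'] {M : κ → Matrix ι'' ι' ℂ} (hM : ∑ i, (M i)ᴴ * M i = 1)
    (N : Matrix ι' ι ℂ) : ∑ i, (M i * N)ᴴ * (M i * N) = Nᴴ * N := by
  have h (i) : (M i * N)ᴴ * (M i * N) = Nᴴ * ((M i)ᴴ * M i) * N := by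
    simp only [Matrix.conjTranspose_mul, Matrix.mul_assoc]
  simp_rw [h]
  rw [← Matrix.sum_mul, ← Matrix.mul_sum, hM, Matrix.mul_one]

/-- Every LOCC map is separable: it has a Kraus decomposition into product operators. -/
theorem IsLOCC.exists_product_kraus {a' b' a b : ℕ} {L : BiOp a b →ₗ[ℂ] BiOp a' b'}
    (h : IsLOCC a' b' a b L) :
    ∃ (κ : Type) (_ : Fintype κ) (A : κ → Matrix (Fin a') (Fin a) ℂ)
      (B : κ → Matrix (Fin b') (Fin b) ℂ),
      ∑ i, (A i ⊗ₖ B i)ᴴ * (A i ⊗ₖ B i) = 1 ∧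
      ∀ X, L X = ∑ i, (A i ⊗ₖ B i) * X * (A i ⊗ₖ B i)ᴴ := by
  induction h with
  | done => exact ⟨Unit, inferInstance, fun _ => 1, fun _ => 1, by simp, by simp⟩
  | @alice a b m r c K hK L hL ih =>
    choose κ hκ A B h1 h2 using ih
    have hf (x i j) : (A x i * K x j) ⊗ₖ B x i
        = (A x i ⊗ₖ B x i) * (K x j ⊗ₖ (1 : Matrix (Fin b) (Fin b) ℂ)) := by
      rw [← Matrix.mul_kronecker_mul, Matrix.mul_one]
    refine ⟨(x : Fin m) × (Fin r × κ x), inferInstance, fun p => A p.1 p.2.2 * K p.1 p.2.1,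
      fun p => B p.1 p.2.2, ?_, fun X => ?_⟩
    · simp_rw [hf]
      simp_rw [Fintype.sum_sigma, Fintype.sum_prod_type,
        sum_conjTranspose_mul_self_comp (h1 _), Matrix.conjTranspose_kronecker,
        ← Matrix.mul_kronecker_mul, Matrix.conjTranspose_one, Matrix.mul_one]
      rw [← Matrix.one_kronecker_one, ← hK]
      ext
      simp [Matrix.sum_apply, Finset.sum_mul]
    · simp only [hf, Fintype.sum_sigma, Fintype.sum_prod_type, h2, conjAlice, LinearMap.sum_apply,
        LinearMap.comp_apply, LinearMap.coe_mk, AddHom.coe_mk, Matrix.mul_sum, Matrix.sum_mul,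
        Matrix.mul_assoc, Matrix.conjTranspose_mul]
      exact Finset.sum_congr rfl fun x _ => Finset.sum_comm
  | @bob a b m r c K hK L hL ih =>
    choose κ hκ A B h1 h2 using ih
    have hf (x i j) : A x i ⊗ₖ (B x i * K x j)
        = (A x i ⊗ₖ B x i) * ((1 : Matrix (Fin a) (Fin a) ℂ) ⊗ₖ K x j) := by
      rw [← Matrix.mul_kronecker_mul, Matrix.mul_one]
    refine ⟨(x : Fin m) × (Fin r × κ x), inferInstance, fun p => A p.1 p.2.2,
      fun p => B p.1 p.2.2 * K p.1 p.2.1, ?_, fun X => ?_⟩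
    · simp_rw [hf]
      simp_rw [Fintype.sum_sigma, Fintype.sum_prod_type,
        sum_conjTranspose_mul_self_comp (h1 _), Matrix.conjTranspose_kronecker,
        ← Matrix.mul_kronecker_mul, Matrix.conjTranspose_one, Matrix.mul_one]
      rw [← Matrix.one_kronecker_one, ← hK]
      ext
      simp [Matrix.sum_apply, Finset.mul_sum]
    · simp only [hf, Fintype.sum_sigma, Fintype.sum_prod_type, h2, conjBob, LinearMap.sum_apply,
        LinearMap.comp_apply, LinearMap.coe_mk, AddHom.coe_mk, Matrix.mul_sum, Matrix.sum_mul,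
        Matrix.mul_assoc, Matrix.conjTranspose_mul]
      exact Finset.sum_congr rfl fun x _ => Finset.sum_comm

/-! ### The one-shot converse -/

/-- The fidelity `⟨φ, L(ψ) φ⟩`, written as the total squared overlap of the Kraus branches of `ψ`
with `φ`, is at least `1 - ‖L(ψ) - φ‖₁`. -/
theorem one_sub_traceNorm_le {a b c d : ℕ} {κ : Type*} [Fintype κ]
    (M : κ → Matrix (Fin c × Fin d) (Fin a × Fin b) ℂ)
    (ψ : EuclideanSpace ℂ (Fin a × Fin b)) {φ : EuclideanSpace ℂ (Fin c × Fin d)} (hφ : ‖φ‖ = 1) :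
    1 - traceNorm (∑ i, M i * pureState ψ * (M i)ᴴ - pureState φ)
      ≤ ∑ i, ‖inner ℂ φ (WithLp.toLp 2 (M i *ᵥ ψ.ofLp))‖ ^ 2 := by
  have hp {a b : ℕ} (x : EuclideanSpace ℂ (Fin a × Fin b)) :
      pureState x = Matrix.vecMulVec x.ofLp (star x.ofLp) := rfl
  set X := ∑ i, M i * pureState ψ * (M i)ᴴ - pureState φ with hX
  have h1 : inner ℂ φ (WithLp.toLp 2 (X *ᵥ φ.ofLp))
      = ((∑ i, ‖inner ℂ φ (WithLp.toLp 2 (M i *ᵥ ψ.ofLp))‖ ^ 2 - 1 : ℝ) : ℂ) := by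
    have hφφ : star φ.ofLp ⬝ᵥ φ.ofLp = 1 := by
      rw [star_dotProduct_self_eq_norm_sq, hφ]; simp
    have hq (i) : star φ.ofLp ⬝ᵥ (M i * pureState ψ * (M i)ᴴ) *ᵥ φ.ofLp
        = ((‖inner ℂ φ (WithLp.toLp 2 (M i *ᵥ ψ.ofLp))‖ ^ 2 : ℝ) : ℂ) := by
      rw [hp, Matrix.mul_vecMulVec, Matrix.vecMulVec_mul, ← Matrix.star_mulVec,
        Matrix.vecMulVec_mulVec, EuclideanSpace.inner_eq_star_dotProduct, Complex.ofReal_pow,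
        ← Complex.conj_mul', dotProduct_comm _ (star φ.ofLp)]
      have hstar : starRingEnd ℂ (star φ.ofLp ⬝ᵥ M i *ᵥ ψ.ofLp)
          = star (M i *ᵥ ψ.ofLp) ⬝ᵥ φ.ofLp := by
        rw [starRingEnd_apply, Matrix.star_dotProduct, star_star]
      rw [hstar, dotProduct_smul, op_smul_eq_mul, mul_comm]
    rw [EuclideanSpace.inner_toLp_toLp, dotProduct_comm, hX, Matrix.sub_mulVec, dotProduct_sub,
      Matrix.sum_mulVec, dotProduct_sum, Finset.sum_congr rfl fun i _ => hq i, hp φ,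
      Matrix.vecMulVec_mulVec, hφφ]
    simp [hφφ]
  have h2 : ‖inner ℂ φ (WithLp.toLp 2 (X *ᵥ φ.ofLp))‖ ≤ traceNorm X := by
    have := (norm_inner_le_norm (𝕜 := ℂ) φ (WithLp.toLp 2 (X *ᵥ φ.ofLp))).trans
      (mul_le_mul_of_nonneg_left (norm_toLp_mulVec_le X φ) (norm_nonneg _))
    simpa [hφ] using this
  rw [h1, Complex.norm_real] at h2
  have := (abs_le.1 h2).1
  linarith

theorem sum_inner_mulVec {ι ι' κ : Type*} [Fintype ι] [Fintype ι'] [DecidableEq ι] [Fintype κ]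
    {M : κ → Matrix ι' ι ℂ} (hM : ∑ i, (M i)ᴴ * M i = 1) (x y : EuclideanSpace ℂ ι) :
    ∑ i, inner ℂ (WithLp.toLp 2 (M i *ᵥ x.ofLp)) (WithLp.toLp 2 (M i *ᵥ y.ofLp))
      = inner ℂ x y := by
  simp_rw [EuclideanSpace.inner_eq_star_dotProduct, dotProduct_comm _ (star _), Matrix.star_mulVec,
    ← Matrix.dotProduct_mulVec, Matrix.mulVec_mulVec]
  rw [← dotProduct_sum, ← Matrix.sum_mulVec, hM, Matrix.one_mulVec]

theorem sum_norm_sq_mulVec {ι ι' κ : Type*} [Fintype ι] [Fintype ι'] [DecidableEq ι] [Fintype κ]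
    {M : κ → Matrix ι' ι ℂ} (hM : ∑ i, (M i)ᴴ * M i = 1) (x : EuclideanSpace ℂ ι) :
    ∑ i, ‖WithLp.toLp 2 (M i *ᵥ x.ofLp)‖ ^ 2 = ‖x‖ ^ 2 := by
  have h := sum_inner_mulVec hM x x
  simp_rw [inner_self_eq_norm_sq_to_K] at h
  exact_mod_cast h

/-- The one-shot converse `W_{ψ^A}(t) - s / t - 2 √‖L(ψ) - φ‖₁ ≤ W_{φ^A}(s)`, where
`W_ρ(t) = Tr ρ {ρ > t}`. -/
theorem IsLOCC.weight_le {a b c d : ℕ} {L : BiOp a b →ₗ[ℂ] BiOp c d} (hL : IsLOCC c d a b L)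
    {ψ : EuclideanSpace ℂ (Fin a × Fin b)} {φ : EuclideanSpace ℂ (Fin c × Fin d)}
    (hψ : ‖ψ‖ = 1) (hφ : ‖φ‖ = 1) {s t : ℝ} (hs : 0 ≤ s) (ht : 0 < t) :
    (partialTraceB (pureState ψ) * posProj (partialTraceB (pureState ψ) - t • 1)).trace.re
        - s / t - 2 * √(traceNorm (L (pureState ψ) - pureState φ))
      ≤ (partialTraceB (pureState φ) *
          posProj (partialTraceB (pureState φ) - s • 1)).trace.re := by
  obtain ⟨κ, _, A, B, hM, hLM⟩ := hL.exists_product_kraus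
  set ρ := partialTraceB (pureState ψ) with hρ
  set P := posProj (ρ - t • 1) with hP
  have hρpsd : ρ.PosSemidef := posSemidef_partialTraceB_pureState ψ
  have hPh : P.IsHermitian := isHermitian_posProj _
  have hPP : P * P = P := posProj_mul_self _
  -- The component of `ψ` on the eigenvectors of `ψ^A` with eigenvalue above `t`.
  let χ : EuclideanSpace ℂ (Fin a × Fin b) :=
    WithLp.toLp 2 ((P ⊗ₖ (1 : Matrix (Fin b) (Fin b) ℂ)) *ᵥ ψ.ofLp)
  have hχ : coeffMatrix χ = P * coeffMatrix ψ := by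
    rw [coeffMatrix_kronecker_mulVec, Matrix.transpose_one, Matrix.mul_one]
  set W := (ρ * P).trace.re with hW
  have hW0 : 0 ≤ W := trace_mul_re_nonneg hρpsd hPh hPP
  have hW1 : W ≤ 1 := by
    refine (trace_mul_posProj_re_le hρpsd _).trans ?_
    rw [hρ, trace_partialTraceB_pureState, hψ]; simp
  have hk : s * P.rank ≤ s / t := by
    have h := (mul_rank_posProj_le hρpsd.isHermitian t).trans hW1
    rw [div_eq_mul_inv, ← one_div]
    gcongr
    rwa [le_div_iff₀' ht]
  have hψχ : inner ℂ ψ χ = (ρ * P).trace := by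
    rw [inner_eq_trace, hχ, ← Matrix.mul_assoc, Matrix.trace_mul_comm, ← Matrix.mul_assoc, hρ,
      partialTraceB_pureState]
  have hχχ : inner ℂ χ χ = inner ℂ ψ χ := by
    rw [inner_eq_trace, inner_eq_trace, hχ, Matrix.conjTranspose_mul, hPh, Matrix.mul_assoc,
      ← Matrix.mul_assoc P P, hPP]
  have hχn : ((‖χ‖ ^ 2 : ℝ) : ℂ) = (ρ * P).trace := by
    rw [← hψχ, ← hχχ, inner_self_eq_norm_sq_to_K]; simp
  have hχW : ‖χ‖ ^ 2 = W := by rw [hW, ← hχn, Complex.ofReal_re]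
  have hWc : (ρ * P).trace = (W : ℂ) := by rw [← hχn, hχW]
  set C := (partialTraceB (pureState φ) *
          posProj (partialTraceB (pureState φ) - s • 1)).trace.re with hC
  have hC0 : 0 ≤ C := trace_mul_re_nonneg (posSemidef_partialTraceB_pureState φ)
    (isHermitian_posProj _) (posProj_mul_self _)
  have := sub_two_mul_sqrt_le_of_overlap
    (fun i => WithLp.toLp 2 ((A i ⊗ₖ B i) *ᵥ ψ.ofLp))
    (fun i => WithLp.toLp 2 ((A i ⊗ₖ B i) *ᵥ χ.ofLp)) hφ hW0 hW1 (C := C + s * P.rank)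
    (η := traceNorm (L (pureState ψ) - pureState φ)) (by positivity)
    (by rw [sum_norm_sq_mulVec hM, hψ, one_pow]) (by rw [sum_norm_sq_mulVec hM, hχW])
    (by rw [sum_inner_mulVec hM, hψχ, hWc])
    (by rw [hLM]; exact one_sub_traceNorm_le _ ψ hφ) (fun i => by
      refine (norm_inner_sq_le_of_rank φ _ hs).trans ?_
      rw [coeffMatrix_kronecker_mulVec, hχ]
      gcongr
      exact (Matrix.rank_mul_le_left _ _).trans
        ((Matrix.rank_mul_le_right _ _).trans (Matrix.rank_mul_le_left _ _)))
  linarith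

end Bipartite

/-! ### The asymptotic converse -/

theorem theorem2 {dA dB : ℕ → ℕ}
    (ψ φ : (n : ℕ) → EuclideanSpace ℂ (Fin (dA n) × Fin (dB n)))
    (hψ : ∀ n, 1 ≤ n → ‖ψ n‖ = 1) (hφ : ∀ n, 1 ≤ n → ‖φ n‖ = 1)
    (hconv : AsympLOCCConvertible ψ φ) (ε : ℝ) (hε : ε ∈ Set.Icc (0 : ℝ) 1) :
    supSpectralEntropy ε (fun n => partialTraceB (pureState (φ n))) ≤
        supSpectralEntropy ε (fun n => partialTraceB (pureState (ψ n))) ∧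
      infSpectralEntropy ε (fun n => partialTraceB (pureState (φ n))) ≤
        infSpectralEntropy ε (fun n => partialTraceB (pureState (ψ n))) := by
  obtain ⟨L, hL, hlim⟩ := hconv
  -- The error of the one-shot converse at `t = e^{na}` and `s = e^{n(a - δ)}`.
  let e (δ : ℝ) (n : ℕ) : ℝ :=
    Real.exp (-(n * δ)) + 2 * √(traceNorm (L n (pureState (ψ n)) - pureState (φ n)))
  have he {δ : ℝ} (hδ : 0 < δ) : Tendsto (e δ) atTop (nhds 0) := by
    have h1 : Tendsto (fun n : ℕ => Real.exp (-(n * δ))) atTop (nhds 0) :=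
      Real.tendsto_exp_neg_atTop_nhds_zero.comp
        (tendsto_natCast_atTop_atTop.atTop_mul_const hδ)
    have h2 := ((Real.continuous_sqrt.tendsto 0).comp hlim).const_mul 2
    simpa [e] using h1.add h2
  have hw (a δ : ℝ) : ∀ᶠ n in atTop,
      spectralWeight (fun n => partialTraceB (pureState (ψ n))) (fun _ => 1) a n - e δ n
        ≤ spectralWeight (fun n => partialTraceB (pureState (φ n))) (fun _ => 1) (a - δ) n := by
    filter_upwards [eventually_ge_atTop 1] with n hn
    have h := (hL n hn).weight_le (hψ n hn) (hφ n hn) (Real.exp_pos (n * (a - δ))).le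
      (Real.exp_pos (n * a))
    rw [← Real.exp_sub, show n * (a - δ) - n * a = -(n * δ) by ring] at h
    simp only [spectralWeight, e]
    linarith
  constructor
  · refine EReal.neg_le_neg_iff.2 (iSup₂_le fun a ha => ?_)
    refine EReal.ge_of_forall_gt_iff_ge.1 fun z hz => ?_
    have hza : 0 < a - z := sub_pos.2 (EReal.coe_lt_coe_iff.1 hz)
    have h := liminf_le_liminf_of_sub_le (he hza) (hw a (a - z))
    rw [sub_sub_cancel] at h
    exact le_iSup₂_of_le z (ha.trans h) le_rfl
  · refine EReal.neg_le_neg_iff.2 (le_iInf₂ fun a ha => ?_)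
    refine EReal.le_of_forall_lt_iff_le.1 fun z hz => ?_
    have hza : 0 < z - a := sub_pos.2 (EReal.coe_lt_coe_iff.1 hz)
    have h := limsup_le_limsup_of_sub_le (he hza) (hw z (z - a))
    rw [sub_sub_cancel] at h
    exact iInf₂_le_of_le z (h.trans ha) le_rfl
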